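/- \textbf{Theorem.} Let $X$ be an infinite topological space (no further assumption on the topology). An \emph{open cover} of $X$ means a countable family $\mathcal U$ of open subsets of $X$ with $\bigcup\mathcal U=X$ and $X\notin\mathcal U$. For $n\in\mathbb N=\{0,1,2,\dots\}$ let $\mathcal O_n$ be the collection of open covers $\mathcal U$ of $X$ such that each $F\subseteq X$ with $|F|\le n$ is contained in some $U\in\mathcal U$. Let $\Omega$ be the collection of open covers $\mathcal U$ of $X$ such that each finite $F\subseteq X$ is contained in some $U\in\mathcal U$. Let $\Omega^{gp}$ be the collection of those $\mathcal U\in\Omega$ that have a partition $\mathcal P$ into finite sets such that for each finite $F\subseteq X$, for all but finitely many $\mathcal F\in\mathcal P$ there is $U\in\mathcal F$ with $F\subseteq U$. For collections $\mathscr A_n$ ($n\in\mathbb N$) and $\mathscr B$ of families of subsets of $X$, in the game $\mathsf G_1(\langle\mathscr A_n\rangle,\mathscr B)$ player ONE chooses in inning $n=0,1,2,\dots$ some $\mathcal U_n\in\mathscr A_n$, and player TWO then chooses some $U_n\in\mathcal U_n$; TWO wins if $\{U_n:n\in\mathbb N\}\in\mathscr B$, and otherwise ONE wins. A strategy for ONE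 must provide a legal move at every position reachable when ONE follows it. Write $\mathsf G_1(\mathscr A,\mathscr B)$ when $\mathscr A_n=\mathscr A$ for all $n$. The space $X$ satisfies $\mathsf S_1(\mathscr A,\mathscr B)$ if for each sequence $(\mathcal U_n)_{n\in\mathbb N}$ of members of $\mathscr A$ there are $U_n\in\mathcal U_n$ with $\{U_n:n\in\mathbb N\}\in\mathscr B$. Let $\mathscr B\in\{\Omega,\Omega^{gp}\}$. Then the following are equivalent: (1) $X$ satisfies $\mathsf S_1(\Omega,\mathscr B)$; (2) ONE does not have a winning strategy in $\mathsf G_1(\Omega,\mathscr B)$; (3) ONE does not have a winning strategy in $\mathsf G_1(\langle\mathcal O_n\rangle,\mathscr B)$. -/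

import Mathlib

namespace SelectionGames

/-- An open cover of `X`: a countable family of open sets with union `X`, none of which is
the whole space `X`. -/
structure IsOpenCover {X : Type*} [TopologicalSpace X] (𝒰 : Set (Set X)) : Prop where
  countable : 𝒰.Countable
  isOpen : ∀ U ∈ 𝒰, IsOpen U
  sUnion_eq : ⋃₀ 𝒰 = Set.univ
  univ_notMem : Set.univ ∉ 𝒰

/-- `𝒪ₙ`: the collection of all open `n`-covers of `X`, the open covers such that every set of
at most `n` points is contained in one member. -/
def openNCovers (X : Type*) [TopologicalSpace X] (n : ℕ) : Set (Set (Set X)) :=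
  {𝒰 | IsOpenCover 𝒰 ∧ ∀ F : Finset X, F.card ≤ n → ∃ U ∈ 𝒰, (F : Set X) ⊆ U}

/-- `Ω`: the collection of all open `ω`-covers of `X`, the open covers such that every finite
set of points is contained in one member. -/
def omegaCovers (X : Type*) [TopologicalSpace X] : Set (Set (Set X)) :=
  {𝒰 | IsOpenCover 𝒰 ∧ ∀ F : Finset X, ∃ U ∈ 𝒰, (F : Set X) ⊆ U}

/-- `𝒬` is a partition of the family `𝒰` into finite (nonempty) sets. -/
structure IsFinitePartition {X : Type*} (𝒰 : Set (Set X)) (𝒬 : Set (Set (Set X))) : Prop where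
  finite : ∀ 𝓕 ∈ 𝒬, 𝓕.Finite
  nonempty : ∀ 𝓕 ∈ 𝒬, 𝓕.Nonempty
  pairwiseDisjoint : 𝒬.PairwiseDisjoint id
  sUnion_eq : ⋃₀ 𝒬 = 𝒰

/-- `Ω^{gp}`: the collection of all groupable open `ω`-covers of `X`, those that have a partition
into finite sets such that, for every finite set `F` of points, all but finitely many pieces of
the partition have a member that contains `F`. -/
def groupableOmegaCovers (X : Type*) [TopologicalSpace X] : Set (Set (Set X)) :=
  {𝒰 | 𝒰 ∈ omegaCovers X ∧ ∃ 𝒬 : Set (Set (Set X)), IsFinitePartition 𝒰 𝒬 ∧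
    ∀ F : Finset X, {𝓕 ∈ 𝒬 | ¬ ∃ U ∈ 𝓕, (F : Set X) ⊆ U}.Finite}

/-- The selection hypothesis `S₁(⟨𝒜ₙ⟩, ℬ)`. -/
def S1 {X : Type*} (𝒜 : ℕ → Set (Set (Set X))) (ℬ : Set (Set (Set X))) : Prop :=
  ∀ 𝒰 : ℕ → Set (Set X), (∀ n, 𝒰 n ∈ 𝒜 n) →
    ∃ U : ℕ → Set X, (∀ n, U n ∈ 𝒰 n) ∧ Set.range U ∈ ℬ

/-- The list `[U 0, …, U (n - 1)]` of the first `n` moves of TWO. -/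
def history {X : Type*} (U : ℕ → Set X) (n : ℕ) : List (Set X) :=
  (List.range n).map U

/-- `F` is a winning strategy for ONE in the game `G₁(⟨𝒜ₙ⟩, ℬ)`. In inning `n` ONE chooses
`𝒰ₙ ∈ 𝒜ₙ`, then TWO chooses `Uₙ ∈ 𝒰ₙ`; TWO wins if `{Uₙ : n ∈ ℕ} ∈ ℬ`, otherwise ONE wins.
A strategy for ONE assigns a move to each list of previous moves of TWO (the previous moves of
ONE are determined by these). It has to provide a legal move at each position that can arise
when ONE follows it, and it wins if every play in which ONE follows it is won by ONE. -/
structure IsWinningStrategyOne {X : Type*} (𝒜 : ℕ → Set (Set (Set X))) (ℬ : Set (Set (Set X)))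
    (F : List (Set X) → Set (Set X)) : Prop where
  legal : ∀ (U : ℕ → Set X) (n : ℕ), (∀ k < n, U k ∈ F (history U k)) → F (history U n) ∈ 𝒜 n
  wins : ∀ U : ℕ → Set X, (∀ n, U n ∈ F (history U n)) → Set.range U ∉ ℬ

/-- ONE has a winning strategy in the game `G₁(⟨𝒜ₙ⟩, ℬ)`. -/
def OneHasWinningStrategyG1 {X : Type*} (𝒜 : ℕ → Set (Set (Set X)))
    (ℬ : Set (Set (Set X))) : Prop :=
  ∃ F : List (Set X) → Set (Set X), IsWinningStrategyOne 𝒜 ℬ F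

end SelectionGames

/-!
Since `Ω ⊆ 𝒪ₙ`, a winning strategy for ONE in the `Ω`-game is also one in the `⟨𝒪ₙ⟩`-game, and a
sequence of covers refuting `S₁(Ω, ℬ)` is itself a winning strategy in the `Ω`-game. The content is
that `S₁(Ω, ℬ)` lets TWO defeat every strategy of ONE in the `⟨𝒪ₙ⟩`-game.

Enumerating the answers of the strategy turns it into a tree: a finite list `p` of natural numbers
codes a position, and `U p j` is the `j`-th available move of TWO there. Moves already made in the
first half of the play are discarded first; the moves left at a position of length `n` still
capture every set of at most `n / 2` points (one of them contains it), and in every branch each set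
is picked only finitely often.

* Selecting finite sets (`exists_finite_selection`): `S₁(Ω, Ω)` gives, for each `s`, a Menger-type
  property for families whose members capture all sets of at most `s` points. This is the passage
  to the power `X ^ s`, made with finite unions of finite intersections of the given open sets.
* A finitely branching subtree (`IsCoverTree.exists_box`): that property, in the manner of
  Hurewicz's theorem on the Menger game, yields `K : ℕ → ℕ` such that for every finite `F` there is
  a level `m` at which each position `p` with entries below `K` has a move `j < K m` with
  `F ⊆ U p j`. As no move is the whole space, there are infinitely many such levels
  (`IsCoverTree.infinite_levels`).
* A branch (`IsCoverTree.exists_branch`): in the manner of Pawlikowski's theorem on the Rothberger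
  game, `S₁(Ω, ℬ)` is applied to the covers `𝒱ₙ` of sets which, at more than `n` levels, lie inside
  a move at every position of the subtree. By Hall's theorem the selected `Vₙ ∈ 𝒱ₙ` can be assigned
  distinct levels `m n`, and TWO plays so that `Vₙ ⊆ W (m n)`.

Hence the play `W` is an `ω`-cover. For `ℬ = Ω^{gp}` groupability is passed from `V` to `W` through
a version for sequences (`IsGroupableSeq`), which is inherited by larger sets; it gives a genuine
partition of the range since each set occurs only finitely often in `W`
(`IsGroupableSeq.range_mem`).
-/

namespace SelectionGames

/-! ### Covers and finite Boolean combinations -/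

variable {X : Type*}

/-- Sets other than the whole space can be avoided: enlarging a finite set `F` by `P` excludes the
members of `S` from containing it. -/
theorem exists_finset_not_subset {S : Set (Set X)} (hS : S.Finite) (h : Set.univ ∉ S) :
    ∃ P : Finset X, P.card ≤ S.ncard ∧ ∀ W ∈ S, ¬ (P : Set X) ⊆ W := by
  classical
  rcases isEmpty_or_nonempty X with hX | hX
  · exact ⟨∅, by simp, fun W hW _ =>
      h (Set.eq_univ_of_forall (s := W) (fun x => (hX.false x).elim) ▸ hW)⟩
  have hx : ∀ W ∈ S, ∃ x, x ∉ W := fun W hW =>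
    (Set.ne_univ_iff_exists_notMem W).1 fun e => h (e ▸ hW)
  choose! f hf using hx
  refine ⟨hS.toFinset.image f, ?_, fun W hW hsub => ?_⟩
  · rw [Set.ncard_eq_toFinset_card S hS]
    exact Finset.card_image_le
  · exact hf W hW (hsub (by simpa using ⟨W, hW, rfl⟩))

theorem isOpenCover_of_finset [TopologicalSpace X]
    {𝒰 : Set (Set X)} (hc : 𝒰.Countable) (ho : ∀ U ∈ 𝒰, IsOpen U)
    (hu : Set.univ ∉ 𝒰) (hF : ∀ F : Finset X, ∃ U ∈ 𝒰, (F : Set X) ⊆ U) : 𝒰 ∈ omegaCovers X := by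
  refine ⟨⟨hc, ho, Set.eq_univ_of_forall fun x => ?_, hu⟩, hF⟩
  obtain ⟨U, hU, hx⟩ := hF {x}
  exact ⟨U, hU, hx (by simp)⟩

/-- The intersections of finitely many members of `𝒞`; the empty intersection is the whole
space. -/
def finInters (𝒞 : Set (Set X)) : Set (Set X) :=
  {V | ∃ 𝒢 : Set (Set X), 𝒢.Finite ∧ 𝒢 ⊆ 𝒞 ∧ V = ⋂₀ 𝒢}

theorem countable_finInters {𝒞 : Set (Set X)} (h : 𝒞.Countable) : (finInters 𝒞).Countable := by
  refine ((Set.countable_ofPred_finite_subset h).image Set.sInter).mono ?_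
  rintro V ⟨𝒢, h1, h2, rfl⟩
  exact ⟨𝒢, ⟨h1, h2⟩, rfl⟩

theorem isOpen_of_mem_finInters [TopologicalSpace X]
    {𝒞 : Set (Set X)} (h : ∀ U ∈ 𝒞, IsOpen U) {V : Set X}
    (hV : V ∈ finInters 𝒞) : IsOpen V := by
  obtain ⟨𝒢, h1, h2, rfl⟩ := hV
  exact h1.isOpen_sInter fun U hU => h U (h2 hU)

/-- The unions of finitely many members of `𝒞`. -/
def finUnions (𝒞 : Set (Set X)) : Set (Set X) :=
  {V | ∃ 𝒢 : Set (Set X), 𝒢.Finite ∧ 𝒢 ⊆ 𝒞 ∧ V = ⋃₀ 𝒢}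

theorem countable_finUnions {𝒞 : Set (Set X)} (h : 𝒞.Countable) : (finUnions 𝒞).Countable := by
  refine ((Set.countable_ofPred_finite_subset h).image Set.sUnion).mono ?_
  rintro V ⟨𝒢, h1, h2, rfl⟩
  exact ⟨𝒢, ⟨h1, h2⟩, rfl⟩

theorem isOpen_of_mem_finUnions [TopologicalSpace X]
    {𝒞 : Set (Set X)} (h : ∀ U ∈ 𝒞, IsOpen U) {V : Set X}
    (hV : V ∈ finUnions 𝒞) : IsOpen V := by
  obtain ⟨𝒢, h1, h2, rfl⟩ := hV
  exact isOpen_sUnion fun U hU => h U (h2 hU)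

/-! ### Finite selections from covers of the sets of at most `s` points -/

/-- If the members of `𝒱` capture all sets of at most `s` points, then each finite `F` lies in a
finite union `V` of finite intersections of members of `𝒱` such that finitely many members of `𝒱`
capture all subsets of `V` of at most `s` points.
This is the tube lemma for the finite set `F ^ s` in `X ^ s`: take the union over `x ∈ F` of the
intersections of the sets chosen for the `A ⊆ F` that contain `x`. -/
theorem exists_superset_finUnions_finInters {𝒱 : Set (Set X)} {s : ℕ}
    (hcov : ∀ F : Finset X, F.card ≤ s → ∃ U ∈ 𝒱, (F : Set X) ⊆ U) (F : Finset X) :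
    ∃ V ∈ finUnions (finInters 𝒱), (F : Set X) ⊆ V ∧ ∃ 𝓕 ⊆ 𝒱, 𝓕.Finite ∧
      ∀ A : Finset X, A.card ≤ s → (A : Set X) ⊆ V → ∃ U ∈ 𝓕, (A : Set X) ⊆ U := by
  classical
  choose! u hu hsub using hcov
  let S : Finset (Finset X) := F.powerset.filter fun A => A.card ≤ s
  let v : X → Set X := fun x => ⋂₀ (u '' {A | A ∈ S ∧ x ∈ A})
  have hmem : ∀ A ∈ S, u A ∈ 𝒱 := fun A hA => hu A (Finset.mem_filter.1 hA).2
  refine ⟨⋃₀ (v '' F), ⟨v '' F, F.finite_toSet.image v, ?_, rfl⟩, ?_, u '' S, ?_,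
    S.finite_toSet.image u, ?_⟩
  · rintro _ ⟨x, -, rfl⟩
    refine ⟨_, Set.Finite.image u (S.finite_toSet.subset fun A hA => hA.1), ?_, rfl⟩
    rintro _ ⟨A, hA, rfl⟩
    exact hmem A hA.1
  · intro x hx
    refine ⟨v x, ⟨x, hx, rfl⟩, ?_⟩
    rintro _ ⟨A, ⟨hA, hxA⟩, rfl⟩
    exact hsub A (Finset.mem_filter.1 hA).2 hxA
  · rintro _ ⟨A, hA, rfl⟩
    exact hmem A hA
  · intro A hA hAV
    have hr : ∀ b ∈ A, ∃ x ∈ F, b ∈ v x := by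
      intro b hb
      obtain ⟨_, ⟨x, hx, rfl⟩, hbx⟩ := hAV hb
      exact ⟨x, hx, hbx⟩
    rcases A.eq_empty_or_nonempty with rfl | ⟨b₀, hb₀⟩
    · exact ⟨u ∅, ⟨∅, by simp [S], rfl⟩, by simp⟩
    have : Nonempty X := ⟨b₀⟩
    choose! r hrF hrv using hr
    have hS : A.image r ∈ S := by
      refine Finset.mem_filter.2 ⟨Finset.mem_powerset.2 ?_, Finset.card_image_le.trans hA⟩
      exact Finset.image_subset_iff.2 hrF
    -- Replacing each point of `A` by a point of `F` whose intersection contains it gives a subset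
    -- of `F`, and the set chosen for that subset captures `A`.
    refine ⟨u (A.image r), ⟨_, hS, rfl⟩, fun b hb => ?_⟩
    exact hrv b hb _ ⟨_, ⟨hS, Finset.mem_image_of_mem r hb⟩, rfl⟩

/-- `S₁(Ω, Ω)` implies a Menger-type property for the families whose members capture all sets of
at most `s` points. -/
theorem exists_finite_selection [TopologicalSpace X]
    (hS : S1 (fun _ => omegaCovers X) (omegaCovers X)) (s : ℕ)
    (𝒱 : ℕ → Set (Set X)) (hc : ∀ n, (𝒱 n).Countable) (ho : ∀ n, ∀ U ∈ 𝒱 n, IsOpen U)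
    (hcov : ∀ n, ∀ F : Finset X, F.card ≤ s → ∃ U ∈ 𝒱 n, (F : Set X) ⊆ U) :
    ∃ 𝓕 : ℕ → Set (Set X), (∀ n, 𝓕 n ⊆ 𝒱 n) ∧ (∀ n, (𝓕 n).Finite) ∧
      ∀ F : Finset X, F.card ≤ s → ∃ n, ∃ U ∈ 𝓕 n, (F : Set X) ⊆ U := by
  classical
  let 𝒲 : ℕ → Set (Set X) := fun n => {V ∈ finUnions (finInters (𝒱 n)) |
    ∃ 𝓕 ⊆ 𝒱 n, 𝓕.Finite ∧
      ∀ A : Finset X, A.card ≤ s → (A : Set X) ⊆ V → ∃ U ∈ 𝓕, (A : Set X) ⊆ U}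
  -- If the whole space belongs to some `𝒲 n`, then `𝒲 n` is not an open cover in the present sense,
  -- but finitely many members of that `𝒱 n` suffice.
  by_cases hX : ∃ n, Set.univ ∈ 𝒲 n
  · obtain ⟨n, -, 𝓕, h1, h2, h3⟩ := hX
    refine ⟨fun i => if i = n then 𝓕 else ∅, fun i => ?_, fun i => ?_, fun F hF => ?_⟩
    · dsimp only; split_ifs with h
      · exact h ▸ h1
      · exact Set.empty_subset _
    · dsimp only; split_ifs
      · exact h2
      · exact Set.finite_empty
    · exact ⟨n, by simpa using h3 F hF (Set.subset_univ _)⟩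
  · push Not at hX
    have hW : ∀ n, 𝒲 n ∈ omegaCovers X := by
      intro n
      refine isOpenCover_of_finset
        ((countable_finUnions (countable_finInters (hc n))).mono fun V hV => hV.1) ?_ (hX n) ?_
      · exact fun V hV => isOpen_of_mem_finUnions
          (fun U hU => isOpen_of_mem_finInters (ho n) hU) hV.1
      · intro F
        obtain ⟨V, h1, h2, h3⟩ := exists_superset_finUnions_finInters (hcov n) F
        exact ⟨V, ⟨h1, h3⟩, h2⟩
    obtain ⟨V, hV, hVΩ⟩ := hS 𝒲 hW
    choose 𝓕 h1 h2 h3 using fun n => (hV n).2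
    refine ⟨𝓕, h1, h2, fun F hF => ?_⟩
    obtain ⟨_, ⟨n, rfl⟩, hn⟩ := hVΩ.2 F
    exact ⟨n, h3 n F hF hn⟩

/-! ### Boxes of positions -/

/-- The list `p`, read with its latest entry at the head, has its `i`-th entry (counted from the
end of the list) below `k i` for all `i`. -/
def InBox (k : ℕ → ℕ) : List ℕ → Prop
  | [] => True
  | j :: p => j < k p.length ∧ InBox k p

theorem InBox.mono {k l : ℕ → ℕ} : ∀ {p : List ℕ}, InBox k p → (∀ i < p.length, k i ≤ l i) →
    InBox l p
  | [], _, _ => trivial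
  | _ :: p, h, hkl => ⟨h.1.trans_le (hkl _ (by simp)),
      h.2.mono fun i hi => hkl i (hi.trans (by simp))⟩

theorem InBox.lt {k : ℕ → ℕ} (hk : Monotone k) : ∀ {p : List ℕ}, InBox k p → ∀ N : ℕ,
    p.length ≤ N + 1 → ∀ x ∈ p, x < k N
  | [], _, _, _ => by simp
  | j :: p, h, N, hp => by
    have hp' : p.length ≤ N := by simpa using hp
    intro x hx
    rcases List.mem_cons.1 hx with rfl | hx
    · exact h.1.trans_le (hk hp')
    · exact h.2.lt hk N (hp'.trans (Nat.le_succ N)) x hx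

theorem finite_lists_bounded (b : ℕ) : ∀ N : ℕ,
    {p : List ℕ | p.length ≤ N ∧ ∀ x ∈ p, x < b}.Finite
  | 0 => (Set.finite_singleton []).subset fun p hp => by simpa using hp.1
  | N + 1 => by
    refine ((Set.finite_singleton []).union
      ((Set.finite_Iio b).image2 List.cons (finite_lists_bounded b N))).subset ?_
    rintro (_ | ⟨j, p⟩) ⟨h1, h2⟩
    · simp
    · refine Or.inr ⟨j, h2 j (by simp), p,
        ⟨by simpa using h1, fun x hx => h2 x (by simp [hx])⟩, rfl⟩

theorem finite_inBox {k : ℕ → ℕ} (hk : Monotone k) (N : ℕ) :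
    {p : List ℕ | p.length ≤ N ∧ InBox k p}.Finite :=
  (finite_lists_bounded (k N) N).subset fun _ hp =>
    ⟨hp.1, hp.2.lt hk N (hp.1.trans (Nat.le_succ N))⟩

/-- Each level of a box is finite, so the bounds can be chosen recursively such that `Φ` respects
them at all positions of the box. -/
theorem exists_monotone_inBox_lt (Φ : List ℕ → ℕ) (a : ℕ) :
    ∃ k : ℕ → ℕ, Monotone k ∧ a ≤ k 0 ∧ ∀ p, InBox k p → Φ p < k p.length := by
  have hg : ∀ b N : ℕ, ∃ g, ∀ p : List ℕ, p.length ≤ N → (∀ x ∈ p, x < b) → Φ p < g := by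
    intro b N
    obtain ⟨g, hg⟩ := ((finite_lists_bounded b N).image Φ).bddAbove
    exact ⟨g + 1, fun p h1 h2 => Nat.lt_succ_of_le (hg ⟨p, ⟨h1, h2⟩, rfl⟩)⟩
  choose g hg using hg
  let k : ℕ → ℕ := fun n => Nat.rec (a + g 0 0) (fun m b => b + g b (m + 1)) n
  have hk : Monotone k := monotone_nat_of_le_succ fun n => Nat.le_add_right _ _
  refine ⟨k, hk, Nat.le_add_right _ _, ?_⟩
  rintro (_ | ⟨j, p⟩) hp
  · exact (hg 0 0 [] (by simp) (by simp)).trans_le (Nat.le_add_left _ _)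
  · exact (hg (k p.length) (p.length + 1) (j :: p) (by simp)
      (hp.lt hk p.length (by simp))).trans_le (Nat.le_add_left _ _)

/-! ### Trees of covers -/

/-- A tree of open sets in which the sets `U p 0, U p 1, …` are the moves available at the position
`p`. They differ from the whole space, and capture all sets of at most `p.length / 2` points. -/
structure IsCoverTree [TopologicalSpace X] (U : List ℕ → ℕ → Set X) : Prop where
  isOpen : ∀ p j, IsOpen (U p j)
  ne_univ : ∀ p j, U p j ≠ Set.univ
  cover : ∀ (p : List ℕ) (F : Finset X), 2 * F.card ≤ p.length → ∃ j, (F : Set X) ⊆ U p j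

/-- All sets that occur as a move in the tree. -/
def treeSets (U : List ℕ → ℕ → Set X) : Set (Set X) :=
  Set.range fun q : List ℕ × ℕ => U q.1 q.2

theorem countable_treeSets (U : List ℕ → ℕ → Set X) : (treeSets U).Countable :=
  Set.countable_range _

theorem IsCoverTree.isOpen_of_mem [TopologicalSpace X]
    {U : List ℕ → ℕ → Set X} (hU : IsCoverTree U) {V : Set X}
    (hV : V ∈ finInters (treeSets U)) : IsOpen V := by
  refine isOpen_of_mem_finInters ?_ hV
  rintro _ ⟨q, rfl⟩
  exact hU.isOpen _ _

/-- The intersection of the moves `U p (Φ p)` over positions of bounded length in a box. -/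
theorem exists_mem_finInters_treeSets {U : List ℕ → ℕ → Set X} {k : ℕ → ℕ} (hk : Monotone k)
    {Q : List ℕ → Prop} {N : ℕ} (hQ : ∀ p, Q p → p.length ≤ N ∧ InBox k p) {Φ : List ℕ → ℕ}
    {F : Set X} (hF : ∀ p, Q p → F ⊆ U p (Φ p)) :
    ∃ V ∈ finInters (treeSets U), F ⊆ V ∧ ∀ p, Q p → V ⊆ U p (Φ p) := by
  refine ⟨⋂₀ ((fun p => U p (Φ p)) '' {p | Q p}),
    ⟨_, Set.Finite.image _ ((finite_inBox hk N).subset hQ), ?_, rfl⟩, ?_, ?_⟩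
  · rintro _ ⟨p, -, rfl⟩
    exact ⟨(p, Φ p), rfl⟩
  · rintro x hx _ ⟨p, hp, rfl⟩
    exact hF p hp hx
  · intro p hp
    exact Set.sInter_subset_of_mem ⟨p, hp, rfl⟩

/-- For sets `F` of `s` points, positions of length at least `2 * s` are relevant. The bounds `k` of
a box whose moves capture `F` at all levels from `2 * s` to `N = 2 * s + 1 + r` depend on `F`, but a
finite selection, made for each `r`, bounds the last value `k N` for a suitable `r` by a number that
does not depend on `F`. The number `a` is a lower bound prescribed for the values of `k`. -/
theorem IsCoverTree.exists_level_bounds [TopologicalSpace X]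
    {U : List ℕ → ℕ → Set X} (hU : IsCoverTree U)
    (hS : S1 (fun _ => omegaCovers X) (omegaCovers X)) (s a : ℕ) :
    ∃ B : ℕ → ℕ, ∀ F : Finset X, F.card = s → ∃ r, ∃ k : ℕ → ℕ, Monotone k ∧ a ≤ k 0 ∧
      k (2 * s + 1 + r) ≤ B r ∧ ∀ p : List ℕ, 2 * s ≤ p.length → p.length ≤ 2 * s + 1 + r →
        InBox k p → ∃ j < k p.length, (F : Set X) ⊆ U p j := by
  let 𝒱 : ℕ → Set (Set X) := fun r => {V ∈ finInters (treeSets U) | ∃ k : ℕ → ℕ,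
    Monotone k ∧ a ≤ k 0 ∧ ∀ p : List ℕ, 2 * s ≤ p.length → p.length ≤ 2 * s + 1 + r →
      InBox k p → ∃ j < k p.length, V ⊆ U p j}
  obtain ⟨𝓕, h1, h2, h3⟩ := exists_finite_selection hS s 𝒱
    (fun r => (countable_finInters (countable_treeSets U)).mono fun V hV => hV.1)
    (fun r V hV => hU.isOpen_of_mem hV.1) (by
      intro r F hF
      have hΦ : ∀ p : List ℕ, 2 * s ≤ p.length → ∃ j, (F : Set X) ⊆ U p j :=
        fun p hp => hU.cover p F (by omega)
      choose! Φ hΦ using hΦ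
      obtain ⟨k, hk, hak, hlt⟩ := exists_monotone_inBox_lt Φ a
      obtain ⟨V, hV, hFV, hVU⟩ := exists_mem_finInters_treeSets (U := U) hk
        (Q := fun p => (p.length ≤ 2 * s + 1 + r ∧ InBox k p) ∧ 2 * s ≤ p.length)
        (fun p hp => hp.1) (Φ := Φ) (F := F) (fun p hp => hΦ p hp.2)
      exact ⟨V, ⟨hV, k, hk, hak, fun p hp1 hp2 hp3 =>
        ⟨Φ p, hlt p hp3, hVU p ⟨⟨hp2, hp3⟩, hp1⟩⟩⟩, hFV⟩)
  choose! k hk hak hkU using fun (r : ℕ) (V : Set X) (hV : V ∈ 𝒱 r) => hV.2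
  have hB : ∀ r, ∃ b, ∀ V ∈ 𝓕 r, k r V (2 * s + 1 + r) ≤ b := by
    intro r
    obtain ⟨b, hb⟩ := ((h2 r).image fun V => k r V (2 * s + 1 + r)).bddAbove
    exact ⟨b, fun V hV => hb ⟨V, hV, rfl⟩⟩
  choose B hB using hB
  refine ⟨B, fun F hF => ?_⟩
  obtain ⟨r, V, hV, hFV⟩ := h3 F hF.le
  have hV' := h1 r hV
  refine ⟨r, k r V, hk r V hV', hak r V hV', hB r V hV, fun p hp1 hp2 hp3 => ?_⟩
  obtain ⟨j, hj, hVj⟩ := hkU r V hV' p hp1 hp2 hp3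
  exact ⟨j, hj, hFV.trans hVj⟩

/-- Hurewicz's argument: a single box contains, for every finite `F`, a level at each position of
which a move inside the box captures `F`. -/
theorem IsCoverTree.exists_box [TopologicalSpace X] {U : List ℕ → ℕ → Set X} (hU : IsCoverTree U)
    (hS : S1 (fun _ => omegaCovers X) (omegaCovers X)) :
    ∃ K : ℕ → ℕ, Monotone K ∧ (∀ m, 0 < K m) ∧ ∀ F : Finset X, ∃ m, ∀ p : List ℕ,
      p.length = m → InBox K p → ∃ j < K m, (F : Set X) ⊆ U p j := by
  choose B hB using hU.exists_level_bounds hS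
  -- The sum makes `K` dominate `B s (K (2 * s)) r` at `2 * s + 1 + r`, for all `s` and `r`.
  let K : ℕ → ℕ := fun n => Nat.rec 1 (fun m b => b +
    ∑ s ∈ Finset.range (m + 1), ∑ a ∈ Finset.range (b + 1), B s a (m - 2 * s)) n
  have hKsucc : ∀ n, K (n + 1) = K n +
    ∑ s ∈ Finset.range (n + 1), ∑ a ∈ Finset.range (K n + 1), B s a (n - 2 * s) := fun _ => rfl
  have hK : Monotone K := monotone_nat_of_le_succ fun n => Nat.le_add_right _ _
  have hKB : ∀ s r, B s (K (2 * s)) r ≤ K (2 * s + 1 + r) := by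
    intro s r
    have e : 2 * s + 1 + r = (2 * s + r) + 1 := by omega
    have h1 : B s (K (2 * s)) (2 * s + r - 2 * s) ≤
        ∑ a ∈ Finset.range (K (2 * s + r) + 1), B s a (2 * s + r - 2 * s) :=
      Finset.single_le_sum (f := fun a => B s a (2 * s + r - 2 * s)) (fun _ _ => Nat.zero_le _)
        (Finset.mem_range.2 (Nat.lt_succ_of_le (hK (Nat.le_add_right _ _))))
    have h2 := Finset.single_le_sum
      (f := fun t => ∑ a ∈ Finset.range (K (2 * s + r) + 1), B t a (2 * s + r - 2 * t))
      (fun _ _ => Nat.zero_le _)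
      (Finset.mem_range.2 (by omega : s < 2 * s + r + 1))
    rw [Nat.add_sub_cancel_left] at h1
    rw [e, hKsucc]
    simp only [Nat.add_sub_cancel_left] at h2
    omega
  refine ⟨K, hK, fun m => (Nat.one_pos).trans_le (hK (Nat.zero_le m)), fun F => ?_⟩
  obtain ⟨r, k, hk, hak, hkB, hkF⟩ := hB F.card (K (2 * F.card)) F rfl
  -- At the least level `m ≥ 2 * F.card` with `k m ≤ K m`, the box of `K` below `m` lies in the box
  -- of `k`: for `i < 2 * F.card` because `K i ≤ K (2 * F.card) ≤ k 0`, for the others by minimality.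
  have hN : 2 * F.card ≤ 2 * F.card + 1 + r ∧ k (2 * F.card + 1 + r) ≤ K (2 * F.card + 1 + r) :=
    ⟨by omega, hkB.trans (hKB _ _)⟩
  obtain ⟨m, ⟨hm1, hm2⟩, hmin⟩ := WellFounded.has_min (wellFounded_lt (α := ℕ))
    {m | 2 * F.card ≤ m ∧ k m ≤ K m} ⟨_, hN⟩
  have hm3 : m ≤ 2 * F.card + 1 + r := not_lt.1 (hmin _ hN)
  refine ⟨m, fun p hp hbox => ?_⟩
  obtain ⟨j, hj, hFj⟩ := hkF p (by omega) (by omega) (hbox.mono fun i hi => by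
    by_cases h : i < 2 * F.card
    · exact ((hK h.le).trans hak).trans (hk (Nat.zero_le i))
    · by_contra! hlt
      exact hmin i ⟨by omega, hlt.le⟩ (by omega))
  rw [hp] at hj
  exact ⟨j, hj.trans_le hm2, hFj⟩

theorem inBox_replicate_zero {K : ℕ → ℕ} (hK : ∀ m, 0 < K m) : ∀ m,
    InBox K (List.replicate m 0)
  | 0 => trivial
  | m + 1 => ⟨by simpa using hK m, inBox_replicate_zero hK m⟩

/-- The finitely many moves inside the box at levels up to `N` are avoided by enlarging `F`. -/
theorem IsCoverTree.infinite_levels [TopologicalSpace X]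
    {U : List ℕ → ℕ → Set X} (hU : IsCoverTree U)
    {K : ℕ → ℕ} (hK : Monotone K) (hpos : ∀ m, 0 < K m)
    (hcov : ∀ F : Finset X, ∃ m, ∀ p : List ℕ,
      p.length = m → InBox K p → ∃ j < K m, (F : Set X) ⊆ U p j) (F : Finset X) :
    {m | ∀ p : List ℕ, p.length = m → InBox K p → ∃ j < K m, (F : Set X) ⊆ U p j}.Infinite := by
  classical
  refine Set.infinite_of_not_bddAbove fun ⟨N, hN⟩ => ?_
  obtain ⟨P, -, hP⟩ := exists_finset_not_subset
    (S := Set.image2 U {p | p.length ≤ N ∧ InBox K p} (Set.Iio (K N)))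
    ((finite_inBox hK N).image2 U (Set.finite_Iio _)) (by
      rintro ⟨p, -, j, -, h⟩
      exact hU.ne_univ p j h)
  obtain ⟨m, hm⟩ := hcov (F ∪ P)
  have hmN : m ≤ N := hN fun p hp hbox => by
    obtain ⟨j, hj, hsub⟩ := hm p hp hbox
    exact ⟨j, hj, (by simp : (F : Set X) ⊆ ↑(F ∪ P)).trans hsub⟩
  obtain ⟨j, hj, hsub⟩ := hm (List.replicate m 0) (by simp) (inBox_replicate_zero hpos m)
  refine hP (U (List.replicate m 0) j) ⟨_, ⟨by simpa using hmN, inBox_replicate_zero hpos m⟩, j,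
    hj.trans_le (hK hmN), rfl⟩ ((by simp : (P : Set X) ⊆ ↑(F ∪ P)).trans hsub)

/-- Distinct representatives exist for finite sets `M n` with more than `n` elements: Hall's
condition for a finite set of indices holds because of its largest index. -/
theorem exists_injective_mem (M : ℕ → Finset ℕ) (hM : ∀ n, n < (M n).card) :
    ∃ m : ℕ → ℕ, Function.Injective m ∧ ∀ n, m n ∈ M n := by
  refine (Finset.all_card_le_biUnion_card_iff_exists_injective M).1 fun s => ?_
  rcases s.eq_empty_or_nonempty with rfl | hs
  · simp
  · have h1 : s ⊆ Finset.range (s.max' hs + 1) := fun i hi =>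
      Finset.mem_range.2 (Nat.lt_succ_of_le (s.le_max' i hi))
    calc s.card ≤ s.max' hs + 1 := by simpa using Finset.card_le_card h1
      _ ≤ (M (s.max' hs)).card := hM _
      _ ≤ _ := Finset.card_le_card (Finset.subset_biUnion_of_mem M (s.max'_mem hs))

/-- Pawlikowski's argument: a branch `P` of the tree with moves `j`, and a member `Set.range V` of
`ℬ` such that the sets `V n` are contained in the moves at distinct levels `m n`. -/
theorem IsCoverTree.exists_branch [TopologicalSpace X] {U : List ℕ → ℕ → Set X} (hU : IsCoverTree U)
    {ℬ : Set (Set (Set X))} (hℬ : ℬ ⊆ omegaCovers X) (hS : S1 (fun _ => omegaCovers X) ℬ) :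
    ∃ (V : ℕ → Set X) (m : ℕ → ℕ) (P : ℕ → List ℕ) (j : ℕ → ℕ), Set.range V ∈ ℬ ∧
      Function.Injective m ∧ P 0 = [] ∧ (∀ n, P (n + 1) = j n :: P n) ∧
      ∀ n, V n ⊆ U (P (m n)) (j (m n)) := by
  classical
  have hSΩ : S1 (fun _ => omegaCovers X) (omegaCovers X) := fun 𝒰 h𝒰 =>
    (hS 𝒰 h𝒰).imp fun V hV => ⟨hV.1, hℬ hV.2⟩
  obtain ⟨K, hK, hpos, hcov⟩ := hU.exists_box hSΩ
  let 𝒱 : ℕ → Set (Set X) := fun n => {V ∈ finInters (treeSets U) | ∃ M : Finset ℕ,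
    n < M.card ∧ ∀ p : List ℕ, p.length ∈ M → InBox K p → ∃ j < K p.length, V ⊆ U p j}
  have h𝒱 : ∀ n, 𝒱 n ∈ omegaCovers X := by
    intro n
    refine isOpenCover_of_finset
      ((countable_finInters (countable_treeSets U)).mono fun V hV => hV.1)
      (fun V hV => hU.isOpen_of_mem hV.1) ?_ fun F => ?_
    · rintro ⟨-, M, hM, h⟩
      obtain ⟨i, hi⟩ := Finset.card_pos.1 (Nat.zero_lt_of_lt hM)
      obtain ⟨j, -, hj⟩ := h (List.replicate i 0) (by simpa using hi)
        (inBox_replicate_zero hpos i)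
      exact hU.ne_univ _ _ (Set.univ_subset_iff.1 hj)
    · obtain ⟨M, hMsub, hMcard⟩ :=
        (hU.infinite_levels hK hpos hcov F).exists_subset_card_eq (n + 1)
      have hΦ : ∀ p : List ℕ, p.length ∈ M ∧ InBox K p → ∃ j < K p.length, (F : Set X) ⊆ U p j :=
        fun p hp => hMsub hp.1 p rfl hp.2
      choose! Φ hΦK hΦ using hΦ
      obtain ⟨V, hV, hFV, hVU⟩ := exists_mem_finInters_treeSets (U := U) hK
        (Q := fun p => p.length ∈ M ∧ InBox K p) (N := M.sup id)
        (fun p hp => ⟨Finset.le_sup (f := id) hp.1, hp.2⟩) hΦ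
      exact ⟨V, ⟨hV, M, by omega, fun p hp hbox => ⟨Φ p, hΦK p ⟨hp, hbox⟩, hVU p ⟨hp, hbox⟩⟩⟩, hFV⟩
  obtain ⟨V, hV, hVB⟩ := hS 𝒱 h𝒱
  choose M hMcard hM using fun n => (hV n).2
  obtain ⟨m, hm, hmM⟩ := exists_injective_mem M hMcard
  have hJ : ∀ p : List ℕ, InBox K p → ∃ j, j < K p.length ∧ ∀ n, m n = p.length → V n ⊆ U p j := by
    intro p hp
    by_cases h : ∃ n, m n = p.length
    · obtain ⟨n, hn⟩ := h
      obtain ⟨j, hj, hVj⟩ := hM n p (hn ▸ hmM n) hp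
      exact ⟨j, hj, fun n' hn' => hm (hn.trans hn'.symm) ▸ hVj⟩
    · exact ⟨0, hpos _, fun n hn => (h ⟨n, hn⟩).elim⟩
  choose! J hJK hJV using hJ
  let P : ℕ → List ℕ := fun n => Nat.rec [] (fun _ p => J p :: p) n
  have hP : ∀ n, (P n).length = n ∧ InBox K (P n) := by
    intro n
    induction n with
    | zero => exact ⟨rfl, trivial⟩
    | succ n ih => exact ⟨congrArg (· + 1) ih.1, hJK _ ih.2, ih.2⟩
  exact ⟨V, m, P, fun n => J (P n), hVB, hm, rfl, fun n => rfl,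
    fun n => hJV _ (hP _).2 n (hP _).1.symm⟩

/-! ### Plays against a strategy of ONE -/

theorem history_succ (W : ℕ → Set X) (n : ℕ) : history W (n + 1) = history W n ++ [W n] := by
  simp [history, List.range_succ]

theorem length_history (W : ℕ → Set X) (n : ℕ) : (history W n).length = n := by
  simp [history]

theorem history_congr {W W' : ℕ → Set X} {n : ℕ} (h : ∀ k < n, W k = W' k) :
    history W n = history W' n :=
  List.map_congr_left fun k hk => h k (List.mem_range.1 hk)

/-- The list `σ` consists of moves of TWO in a partial play in which ONE follows `F`. -/
def Reachable (F : List (Set X) → Set (Set X)) (σ : List (Set X)) : Prop :=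
  ∃ W : ℕ → Set X, history W σ.length = σ ∧ ∀ k < σ.length, W k ∈ F (history W k)

theorem reachable_nil (F : List (Set X) → Set (Set X)) : Reachable F [] :=
  ⟨fun _ => ∅, rfl, fun k hk => absurd hk (Nat.not_lt_zero k)⟩

theorem Reachable.append {F : List (Set X) → Set (Set X)} {σ : List (Set X)}
    (hσ : Reachable F σ) {W : Set X} (hW : W ∈ F σ) : Reachable F (σ ++ [W]) := by
  obtain ⟨V, hV, hVF⟩ := hσ
  have hc : ∀ k ≤ σ.length, history (Function.update V σ.length W) k = history V k :=
    fun k hk => history_congr fun i hi => Function.update_of_ne (by omega) _ _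
  refine ⟨Function.update V σ.length W, ?_, fun k hk => ?_⟩
  · rw [List.length_append, List.length_singleton, history_succ, hc _ le_rfl, hV]
    simp
  · have hk' : k < σ.length ∨ k = σ.length := by
      simp only [List.length_append, List.length_singleton] at hk
      omega
    rcases hk' with hk' | rfl
    · rw [hc k hk'.le, Function.update_of_ne hk'.ne]
      exact hVF k hk'
    · rw [hc _ le_rfl, Function.update_self, hV]
      exact hW

/-- The moves available to TWO that were not made in the first half of the play so far. -/
def freshMoves (F : List (Set X) → Set (Set X)) (σ : List (Set X)) : Set (Set X) :=
  {W ∈ F σ | W ∉ σ.take (σ.length / 2)}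

/-- One point outside each move of the first half, added to `A`, forces a new move; half of the
capacity of the `n`-cover is spent on these points. -/
theorem exists_mem_freshMoves [TopologicalSpace X]
    {F : List (Set X) → Set (Set X)} {σ : List (Set X)}
    (h : F σ ∈ openNCovers X σ.length) (hσ : Set.univ ∉ σ) {A : Finset X}
    (hA : 2 * A.card ≤ σ.length) : ∃ W ∈ freshMoves F σ, (A : Set X) ⊆ W := by
  classical
  obtain ⟨P, hPc, hP⟩ := exists_finset_not_subset
    (S := ((σ.take (σ.length / 2)).toFinset : Set (Set X))) (Finset.finite_toSet _)
    (fun hu => hσ (List.mem_of_mem_take (by simpa using hu)))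
  have hcard : P.card ≤ σ.length / 2 := by
    refine hPc.trans ?_
    rw [Set.ncard_coe_finset]
    exact (List.toFinset_card_le _).trans (by simp)
  obtain ⟨W, hW, hsub⟩ := h.2 (A ∪ P) ((Finset.card_union_le A P).trans (by omega))
  refine ⟨W, ⟨hW, fun hmem => ?_⟩, (by simp : (A : Set X) ⊆ ↑(A ∪ P)).trans hsub⟩
  exact hP W (by simpa using hmem) ((by simp : (P : Set X) ⊆ ↑(A ∪ P)).trans hsub)

/-- A play against a strategy of ONE in the `⟨𝒪ₙ⟩`-game that contains, along an injection, supersets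
of the members of a sequence with range in `ℬ`, and repeats no set from inning `i` at or after
inning `2 * i + 2`. -/
theorem exists_play [TopologicalSpace X] {F : List (Set X) → Set (Set X)}
    (hF : ∀ (U : ℕ → Set X) (n : ℕ), (∀ k < n, U k ∈ F (history U k)) →
      F (history U n) ∈ openNCovers X n)
    {ℬ : Set (Set (Set X))} (hℬ : ℬ ⊆ omegaCovers X) (hS : S1 (fun _ => omegaCovers X) ℬ) :
    ∃ (V W : ℕ → Set X) (m : ℕ → ℕ), Set.range V ∈ ℬ ∧ Function.Injective m ∧
      (∀ n, V n ⊆ W (m n)) ∧ (∀ n, W n ∈ F (history W n)) ∧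
      ∀ i n, 2 * i + 2 ≤ n → W n ≠ W i := by
  classical
  have hleg : ∀ σ, Reachable F σ → F σ ∈ openNCovers X σ.length := by
    rintro σ ⟨W, h1, h2⟩
    have := hF W σ.length h2
    rwa [h1] at this
  have huniv : ∀ σ, Reachable F σ → Set.univ ∉ σ := by
    rintro σ ⟨W, h1, h2⟩ hu
    rw [← h1] at hu
    obtain ⟨k, hk, hkW⟩ := List.mem_map.1 hu
    have hk' := List.mem_range.1 hk
    exact (hF W k fun i hi => h2 i (hi.trans hk')).1.univ_notMem (hkW ▸ h2 k hk')
  have hfresh : ∀ σ, Reachable F σ → ∀ A : Finset X, 2 * A.card ≤ σ.length →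
      ∃ W ∈ freshMoves F σ, (A : Set X) ⊆ W :=
    fun σ hσ A hA => exists_mem_freshMoves (hleg σ hσ) (huniv σ hσ) hA
  have henum : ∀ σ, Reachable F σ → ∃ e : ℕ → Set X, freshMoves F σ = Set.range e := by
    intro σ hσ
    refine Set.Countable.exists_eq_range ((hleg σ hσ).1.countable.mono fun W hW => hW.1) ?_
    obtain ⟨W, hW, -⟩ := hfresh σ hσ ∅ (by simp)
    exact ⟨W, hW⟩
  choose! e he using henum
  -- The history coded by a list of indices.
  let h : List ℕ → List (Set X) := fun p => List.rec [] (fun j _ σ => σ ++ [e σ j]) p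
  have hcons : ∀ j p, h (j :: p) = h p ++ [e (h p) j] := fun _ _ => rfl
  have hreach : ∀ p, Reachable F (h p) ∧ (h p).length = p.length := by
    intro p
    induction p with
    | nil => exact ⟨reachable_nil F, rfl⟩
    | cons j p ih =>
      have hj : e (h p) j ∈ freshMoves F (h p) := he _ ih.1 ▸ Set.mem_range_self j
      rw [hcons]
      exact ⟨ih.1.append hj.1, by simp [ih.2]⟩
  have hmem : ∀ p j, e (h p) j ∈ freshMoves F (h p) := fun p j =>
    he _ (hreach p).1 ▸ Set.mem_range_self j
  have hU : IsCoverTree fun p j => e (h p) j := by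
    refine ⟨fun p j => (hleg _ (hreach p).1).1.isOpen _ (hmem p j).1, fun p j hu => ?_,
      fun p A hA => ?_⟩
    · exact (hleg _ (hreach p).1).1.univ_notMem (hu ▸ (hmem p j).1)
    · obtain ⟨W, hW, hAW⟩ := hfresh _ (hreach p).1 A (by rwa [(hreach p).2])
      rw [he _ (hreach p).1] at hW
      obtain ⟨j, rfl⟩ := hW
      exact ⟨j, hAW⟩
  obtain ⟨V, m, P, j, hV, hm, hP0, hP, hVU⟩ := hU.exists_branch hℬ hS
  let W : ℕ → Set X := fun n => e (h (P n)) (j n)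
  have hW : ∀ n, history W n = h (P n) := by
    intro n
    induction n with
    | zero => rw [hP0]; rfl
    | succ n ih => rw [history_succ, ih, hP, hcons]
  refine ⟨V, W, m, hV, hm, hVU, fun n => ?_, fun i n hin heq => ?_⟩
  · rw [hW]; exact (hmem _ _).1
  · have h1 : W n ∉ (history W n).take ((history W n).length / 2) := by
      rw [hW]; exact (hmem _ _).2
    apply h1
    rw [heq, length_history, history, ← List.map_take, List.take_range]
    exact List.mem_map.2 ⟨i, List.mem_range.2 (by omega), rfl⟩

/-! ### Groupable sequences -/

/-- Groupability of a sequence of sets: there are finite sets `I k` of indices, each index belonging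
to finitely many of them, such that every finite `F` is captured in all but finitely many groups.
Disjointness is not required, and in this form the notion is inherited by larger sets. -/
def IsGroupableSeq (V : ℕ → Set X) : Prop :=
  ∃ I : ℕ → Finset ℕ, (∀ n, {k | n ∈ I k}.Finite) ∧
    ∀ F : Finset X, {k | ¬ ∃ n ∈ I k, (F : Set X) ⊆ V n}.Finite

theorem isGroupableSeq_of_range_mem [TopologicalSpace X] {V : ℕ → Set X}
    (h : Set.range V ∈ groupableOmegaCovers X) : IsGroupableSeq V := by
  classical
  obtain ⟨hΩ, 𝒬, h𝒬, hF⟩ := h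
  have hinf : 𝒬.Infinite := by
    intro hfin
    have hr : (Set.range V).Finite := h𝒬.sUnion_eq ▸ hfin.sUnion h𝒬.finite
    obtain ⟨P, -, hP⟩ := exists_finset_not_subset hr hΩ.1.univ_notMem
    obtain ⟨U, hU, hPU⟩ := hΩ.2 P
    exact hP U hU hPU
  let q := hinf.natEmbedding
  have hρ : ∀ W ∈ Set.range V, ∃ n, V n = W := fun W hW => hW
  choose! ρ hρ using hρ
  have hqV : ∀ k, ∀ W ∈ (q k : Set (Set X)), W ∈ Set.range V := fun k W hW =>
    h𝒬.sUnion_eq ▸ ⟨_, (q k).2, hW⟩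
  refine ⟨fun k => (h𝒬.finite _ (q k).2).toFinset.image ρ, fun n => ?_, fun F => ?_⟩
  · refine Set.Subsingleton.finite fun k hk l hl => ?_
    simp only [Set.mem_ofPred_eq, Finset.mem_image, Set.Finite.mem_toFinset] at hk hl
    obtain ⟨W, hW, hWn⟩ := hk
    obtain ⟨W', hW', hWn'⟩ := hl
    have e : W = W' := by rw [← hρ W (hqV k W hW), ← hρ W' (hqV l W' hW'), hWn, hWn']
    by_contra hne
    have hd := h𝒬.pairwiseDisjoint (q k).2 (q l).2
      fun e' => hne (q.injective (Subtype.ext e'))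
    exact Set.disjoint_left.1 hd hW (e ▸ hW')
  · refine ((hF F).preimage (f := fun k => (q k : Set (Set X)))
      fun k _ l _ e => q.injective (Subtype.ext e)).subset fun k hk => ?_
    refine ⟨(q k).2, fun ⟨U, hU, hFU⟩ => hk ⟨ρ U, ?_, ?_⟩⟩
    · simpa using ⟨U, hU, rfl⟩
    · rwa [hρ U (hqV k U hU)]

theorem IsGroupableSeq.of_subset {V W : ℕ → Set X} {m : ℕ → ℕ} (hV : IsGroupableSeq V)
    (hm : Function.Injective m) (h : ∀ n, V n ⊆ W (m n)) : IsGroupableSeq W := by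
  classical
  obtain ⟨I, h1, h2⟩ := hV
  refine ⟨fun k => (I k).image m, fun n => ?_, fun F => ?_⟩
  · by_cases hn : ∃ i, m i = n
    · obtain ⟨i, rfl⟩ := hn
      refine (h1 i).subset fun k hk => ?_
      obtain ⟨i', hi', e⟩ := Finset.mem_image.1 hk
      exact hm e ▸ hi'
    · refine Set.finite_empty.subset fun k hk => ?_
      obtain ⟨i', -, e⟩ := Finset.mem_image.1 hk
      exact hn ⟨i', e⟩
  · refine (h2 F).subset fun k hk => fun ⟨n, hn, hFn⟩ => hk ?_
    exact ⟨m n, Finset.mem_image_of_mem m hn, hFn.trans (h n)⟩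

theorem IsGroupableSeq.range_mem [TopologicalSpace X] {W : ℕ → Set X} (hW : IsGroupableSeq W)
    (hΩ : Set.range W ∈ omegaCovers X) (hfin : ∀ i, {n | W n = W i}.Finite) :
    Set.range W ∈ groupableOmegaCovers X := by
  classical
  obtain ⟨I, hI, hIF⟩ := hW
  have hex : ∀ n, ∃ i, W i = W n := fun n => ⟨n, rfl⟩
  -- `ν n` is the first inning in which the set `W n` occurs.
  let ν : ℕ → ℕ := fun n => Nat.find (hex n)
  have hν : ∀ n, W (ν n) = W n := fun n => Nat.find_spec (hex n)
  have hν_le : ∀ {n i}, W i = W n → ν n ≤ i := fun {n i} h => Nat.find_min' (hex n) h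
  have hν_congr : ∀ {n i}, W i = W n → ν i = ν n := fun {n i} h =>
    le_antisymm (hν_le ((hν n).trans h.symm)) (hν_le ((hν i).trans h))
  -- As each set occurs finitely often, only finitely many groups meet the sets first occurring
  -- before `a`.
  have hloc : ∀ a, {k | ∃ n ∈ I k, ν n < a}.Finite := by
    intro a
    refine Set.Finite.subset (Set.Finite.biUnion (Set.finite_Iio a) fun i _ =>
      (hfin i).biUnion fun n _ => hI n) ?_
    rintro k ⟨n, hn, hna⟩
    exact Set.mem_biUnion (x := ν n) hna (Set.mem_biUnion (x := n) (hν n).symm hn)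
  have hstep : ∀ a : ℕ, ∃ k b : ℕ, a ≤ k ∧ a < b ∧ (I k).Nonempty ∧
      ∀ n ∈ I k, a ≤ ν n ∧ ν n < b := by
    intro a
    obtain ⟨k, hk⟩ := ((hloc a).union ((hIF ∅).union (Set.finite_Iio a))).infinite_compl.nonempty
    simp only [Set.mem_compl_iff, Set.mem_union, not_or, Set.mem_ofPred_eq, not_not,
      Set.mem_Iio, not_lt] at hk
    obtain ⟨hk1, ⟨n, hn, -⟩, hk3⟩ := hk
    refine ⟨k, a + (I k).sup ν + 1, hk3, by omega, ⟨n, hn⟩, fun i hi => ⟨?_, ?_⟩⟩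
    · by_contra! hlt
      exact hk1 ⟨i, hi, hlt⟩
    · have := Finset.le_sup (f := ν) hi
      omega
  choose κ β hκ hβ hne hmem using hstep
  let a : ℕ → ℕ := fun j => Nat.rec 0 (fun _ x => β x) j
  have ha : StrictMono a := strictMono_nat_of_lt_succ fun j => hβ (a j)
  -- The pieces collect the sets by first occurrence, in intervals that each contain the first
  -- occurrences of a whole group.
  let Q : ℕ → Set (Set X) := fun j => W '' {n | a j ≤ ν n ∧ ν n < a (j + 1)}
  have hQ : ∀ {j n}, W n ∈ Q j → a j ≤ ν n ∧ ν n < a (j + 1) := by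
    rintro j n ⟨i, hi, e⟩
    rw [← hν_congr e]
    exact hi
  refine ⟨hΩ, Set.range Q, ⟨?_, ?_, ?_, ?_⟩, fun F => ?_⟩
  · rintro _ ⟨j, rfl⟩
    refine ((Set.finite_Iio (a (j + 1))).image W).subset ?_
    rintro _ ⟨n, hn, rfl⟩
    exact ⟨ν n, hn.2, hν n⟩
  · rintro _ ⟨j, rfl⟩
    obtain ⟨n, hn⟩ := hne (a j)
    exact ⟨W n, n, hmem (a j) n hn, rfl⟩
  · rintro _ ⟨i, rfl⟩ _ ⟨j, rfl⟩ hij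
    refine Set.disjoint_left.2 ?_
    rintro _ ⟨n, hn, rfl⟩ hnj
    have hn' := hQ hnj
    have hij' : i ≠ j := fun e => hij (e ▸ rfl)
    rcases lt_or_gt_of_ne hij' with h | h
    · have := ha.monotone (Nat.succ_le_of_lt h)
      have := hn.2
      simp only [Nat.succ_eq_add_one] at *
      omega
    · have := ha.monotone (Nat.succ_le_of_lt h)
      have := hn.1
      simp only [Nat.succ_eq_add_one] at *
      omega
  · refine Set.Subset.antisymm ?_ ?_
    · rintro _ ⟨_, ⟨j, rfl⟩, ⟨n, -, rfl⟩⟩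
      exact ⟨n, rfl⟩
    · rintro _ ⟨n, rfl⟩
      have hex' : ∃ j, ν n < a (j + 1) := ⟨ν n, (Nat.lt_succ_self _).trans_le (ha.id_le _)⟩
      refine ⟨Q (Nat.find hex'), ⟨_, rfl⟩, n, ⟨?_, Nat.find_spec hex'⟩, rfl⟩
      rcases hj : Nat.find hex' with _ | j
      · exact Nat.zero_le _
      · by_contra! hlt
        exact Nat.find_min hex' (m := j) (by omega) hlt
  · have hfinj : {j | κ (a j) ∈ {k | ¬ ∃ n ∈ I k, (F : Set X) ⊆ W n}}.Finite := by
      obtain ⟨b, hb⟩ := (hIF F).bddAbove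
      refine (Set.finite_Iic b).subset fun j hj => ?_
      exact ((ha.id_le j).trans (hκ (a j))).trans (hb hj)
    refine (hfinj.image Q).subset ?_
    rintro _ ⟨⟨j, rfl⟩, hj⟩
    refine ⟨j, fun ⟨n, hn, hFn⟩ => hj ⟨W n, ⟨n, hmem (a j) n hn, rfl⟩, hFn⟩, rfl⟩

/-! ### The games -/

theorem not_oneHasWinningStrategy_openNCovers [TopologicalSpace X] {ℬ : Set (Set (Set X))}
    (hℬ : ℬ = omegaCovers X ∨ ℬ = groupableOmegaCovers X)
    (hS : S1 (fun _ => omegaCovers X) ℬ) :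
    ¬ OneHasWinningStrategyG1 (fun n => openNCovers X n) ℬ := by
  rintro ⟨F, hF⟩
  have hsub : ℬ ⊆ omegaCovers X := by
    rcases hℬ with rfl | rfl
    · exact subset_rfl
    · exact fun 𝒰 h => h.1
  obtain ⟨V, W, m, hV, hm, hVW, hWF, hWne⟩ := exists_play hF.legal hsub hS
  have hcov : ∀ n, IsOpenCover (F (history W n)) := fun n => (hF.legal W n fun k _ => hWF k).1
  have hΩ : Set.range W ∈ omegaCovers X := by
    refine isOpenCover_of_finset (Set.countable_range W) ?_ ?_ fun A => ?_
    · rintro _ ⟨n, rfl⟩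
      exact (hcov n).isOpen _ (hWF n)
    · rintro ⟨n, hn⟩
      exact (hcov n).univ_notMem (hn ▸ hWF n)
    · obtain ⟨_, ⟨n, rfl⟩, hn⟩ := (hsub hV).2 A
      exact ⟨W (m n), ⟨_, rfl⟩, hn.trans (hVW n)⟩
  refine hF.wins W hWF ?_
  rcases hℬ with rfl | rfl
  · exact hΩ
  · refine ((isGroupableSeq_of_range_mem hV).of_subset hm hVW).range_mem hΩ fun i => ?_
    refine (Set.finite_Iio (2 * i + 2)).subset fun n hn => ?_
    by_contra h
    exact hWne i n (not_lt.1 h) hn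

theorem OneHasWinningStrategyG1.mono {𝒜 𝒜' : ℕ → Set (Set (Set X))} {ℬ : Set (Set (Set X))}
    (h : ∀ n, 𝒜 n ⊆ 𝒜' n) : OneHasWinningStrategyG1 𝒜 ℬ → OneHasWinningStrategyG1 𝒜' ℬ :=
  fun ⟨F, hF⟩ => ⟨F, fun U n hU => h n (hF.legal U n hU), hF.wins⟩

theorem S1.of_not_oneHasWinningStrategy {𝒜 : ℕ → Set (Set (Set X))} {ℬ : Set (Set (Set X))}
    (h : ¬ OneHasWinningStrategyG1 𝒜 ℬ) : S1 𝒜 ℬ := by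
  intro 𝒰 h𝒰
  by_contra! hno
  refine h ⟨fun σ => 𝒰 σ.length, fun U n _ => ?_, fun U hU => hno U fun n => ?_⟩
  · simpa only [length_history] using h𝒰 n
  · simpa only [length_history] using hU n

end SelectionGames

theorem mainTheorem5 {X : Type*} [TopologicalSpace X] [Infinite X] (ℬ : Set (Set (Set X)))
    (hℬ : ℬ = SelectionGames.omegaCovers X ∨ ℬ = SelectionGames.groupableOmegaCovers X) :
    List.TFAE
      [SelectionGames.S1 (fun _ => SelectionGames.omegaCovers X) ℬ,
       ¬ SelectionGames.OneHasWinningStrategyG1 (fun _ => SelectionGames.omegaCovers X) ℬ,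
       ¬ SelectionGames.OneHasWinningStrategyG1 (fun n => SelectionGames.openNCovers X n) ℬ] := by
  tfae_have 1 → 3 := SelectionGames.not_oneHasWinningStrategy_openNCovers hℬ
  tfae_have 3 → 2 := fun h h' =>
    h (h'.mono fun n 𝒰 h𝒰 => ⟨h𝒰.1, fun F _ => h𝒰.2 F⟩)
  tfae_have 2 → 1 := SelectionGames.S1.of_not_oneHasWinningStrategy
  tfae_finish
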